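/- Let $K$ be a (not necessarily commutative) field, i.e. a division ring, with centre $Z$, and let $U$ be a left vector space over $K$ of finite or infinite dimension greater than $1$. Let $R=\operatorname{End}_K(U)$ be its endomorphism ring, where endomorphisms are written on the right of their arguments, so that a product $\alpha\beta$ means first $\alpha$, then $\beta$; embed $Z$ in $R$ by $a\mapsto a\cdot\mathrm{id}_U$. For a ring $S$ with $1$, let $GL(2,S)$ act from the right on the free left module $S^2$ of row vectors and on its submodules. The projective line $\mathbb{P}(S)$ is the $GL(2,S)$-orbit of the submodule $S(1,0)$. Points $p,q\in\mathbb{P}(S)$ are called distant if the pair $(p,q)$ lies in the $GL(2,S)$-orbit of the pair $(S(1,0),S(0,1))$; the distant graph on $\mathbb{P}(S)$ has vertex set $\mathbb{P}(S)$, its edges being the $2$-sets of distant points. Via $Z(a,b)\mapsto R(a,b)$ the projective line $\mathbb{P}(Z)$ is regarded as a subset of $\mathbb{P}(R)$; the images of this subset under $GL(2,R)$ are the $Z$-chains, and the chain geometry $\Sigma(Z,R)$ consists of the point set $\mathbb{P}(R)$ together with all $Z$-chains. Then the automorphisms of the distant graph on $\mathbb{P}(R)$ are precisely the automorphisms of the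 chain geometry $\Sigma(Z,R)$. That is, a permutation $\sigma$ of $\mathbb{P}(R)$ preserves adjacency in the distant graph in both directions if, and only if, it preserves $Z$-chains in both directions (for every $C\subseteq\mathbb{P}(R)$, the set $\sigma(C)$ is a $Z$-chain if and only if $C$ is one). -/

import Mathlib

namespace ChainGeometry

/-- The group `GL(2, S)` of invertible `2 × 2` matrices over a (not necessarily commutative)
ring `S`. -/
abbrev GL2 (S : Type*) [Ring S] : Type _ := (Matrix (Fin 2) (Fin 2) S)ˣ

/-- The action of `g ∈ GL(2, S)` on the submodules of the free left module `S²` of row vectors,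
induced by `x ↦ x * g`. -/
def moveSubmodule {S : Type*} [Ring S] (g : GL2 S) (p : Submodule S (Fin 2 → S)) :
    Submodule S (Fin 2 → S) :=
  p.map (Matrix.vecMulLinear (g : Matrix (Fin 2) (Fin 2) S))

/-- The cyclic submodule `S(a, b)` of the left module `S²`. -/
def cyclic {S : Type*} [Ring S] (a b : S) : Submodule S (Fin 2 → S) :=
  Submodule.span S {![a, b]}

/-- The projective line over `S`: the orbit of `S(1, 0)` under `GL(2, S)`. -/
def projLine (S : Type*) [Ring S] : Set (Submodule S (Fin 2 → S)) :=
  {p | ∃ g : GL2 S, p = moveSubmodule g (cyclic 1 0)}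

theorem moveSubmodule_mul {S : Type*} [Ring S] (g h : GL2 S)
    (p : Submodule S (Fin 2 → S)) :
    moveSubmodule (g * h) p = moveSubmodule h (moveSubmodule g p) := by
  unfold moveSubmodule
  rw [← Submodule.map_comp]
  congr 1
  refine LinearMap.ext fun v => ?_
  simp [Matrix.vecMul_vecMul]

theorem moveSubmodule_cyclic {S : Type*} [Ring S] (g : GL2 S) (a b : S) :
    moveSubmodule g (cyclic a b) =
      cyclic (a * g.1 0 0 + b * g.1 1 0) (a * g.1 0 1 + b * g.1 1 1) := by
  unfold moveSubmodule cyclic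
  rw [Submodule.map_span, Set.image_singleton]
  congr 2
  ext i
  fin_cases i <;> simp [Matrix.vecMul, dotProduct, Fin.sum_univ_two]

/-- The action of `GL(2, S)` on the points of the projective line. -/
def movePoint {S : Type*} [Ring S] (g : GL2 S) (p : projLine S) : projLine S :=
  ⟨moveSubmodule g p.1, by
    obtain ⟨h, hh⟩ := p.2
    exact ⟨h * g, by rw [hh, moveSubmodule_mul]⟩⟩

/-- The matrix that interchanges the two coordinates. -/
def swapMatrix (S : Type*) [Ring S] : GL2 S :=
  ⟨!![0, 1; 1, 0], !![0, 1; 1, 0],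
    by simp [Matrix.one_fin_two],
    by simp [Matrix.one_fin_two]⟩

/-- Two points are distant if they form a pair in the `GL(2, S)`-orbit of the pair
`(S(1, 0), S(0, 1))`. -/
def Distant {S : Type*} [Ring S] (p q : projLine S) : Prop :=
  ∃ g : GL2 S, p.1 = moveSubmodule g (cyclic 1 0) ∧ q.1 = moveSubmodule g (cyclic 0 1)

theorem Distant.symm {S : Type*} [Ring S] {p q : projLine S} (h : Distant p q) :
    Distant q p := by
  obtain ⟨g, hp, hq⟩ := h
  refine ⟨swapMatrix S * g, ?_, ?_⟩
  · rw [hq, moveSubmodule_mul, moveSubmodule_cyclic (swapMatrix S)]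
    simp [swapMatrix]
  · rw [hp, moveSubmodule_mul, moveSubmodule_cyclic (swapMatrix S)]
    simp [swapMatrix]

/-- The distant graph: the edges are the `2`-sets of distant points. -/
def distantGraph (S : Type*) [Ring S] : SimpleGraph (projLine S) where
  Adj p q := p ≠ q ∧ Distant p q
  symm := ⟨fun _ _ h => ⟨h.1.symm, h.2.symm⟩⟩
  loopless := ⟨fun _ h => h.1 rfl⟩

/-- The image of the projective line over `F` in the projective line over `S` under
`F(a, b) ↦ S(a, b)`, where `F` is embedded in `S` by `φ`. -/
def standardChain {F S : Type*} [Ring F] [Ring S] (φ : F →+* S) : Set (projLine S) :=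
  {p | ∃ a b : F, cyclic a b ∈ projLine F ∧ p.1 = cyclic (φ a) (φ b)}

/-- The set of `F`-chains: the `GL(2, S)`-orbit of the standard chain. -/
def chains {F S : Type*} [Ring F] [Ring S] (φ : F →+* S) : Set (Set (projLine S)) :=
  {C | ∃ g : GL2 S, C = movePoint g '' standardChain φ}

/-- The submodule `S(a, b)` is a point of the projective line over `S` whenever `F(a, b)` is one
of the projective line over `F`; so `standardChain` contains all of these submodules. -/
theorem cyclic_map_mem_projLine {F S : Type*} [Ring F] [Ring S] (φ : F →+* S) {a b : F}
    (h : cyclic a b ∈ projLine F) : cyclic (φ a) (φ b) ∈ projLine S := by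
  obtain ⟨g, hg⟩ := h
  refine ⟨Units.map φ.mapMatrix.toMonoidHom g, ?_⟩
  rw [moveSubmodule_cyclic] at hg ⊢
  have key : ∀ {a b c d : F}, cyclic a b ≤ cyclic c d →
      cyclic (φ a) (φ b) ≤ cyclic (φ c) (φ d) := by
    intro a b c d hle
    have h1 : ![a, b] ∈ cyclic c d := hle (Submodule.mem_span_singleton_self _)
    obtain ⟨r, hr⟩ := Submodule.mem_span_singleton.1 h1
    have h2 : r * c = a := by simpa using congrFun hr 0
    have h3 : r * d = b := by simpa using congrFun hr 1
    unfold cyclic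
    rw [Submodule.span_singleton_le_iff_mem, Submodule.mem_span_singleton]
    exact ⟨φ r, by simp [← h2, ← h3]⟩
  have := le_antisymm (key hg.le) (key hg.ge)
  simpa using this

/-- The endomorphism ring of a left vector space, with endomorphisms written on the right of their
arguments: the product `α * β` means first `α`, then `β`. -/
abbrev EndRight (K U : Type*) [DivisionRing K] [AddCommGroup U] [Module K U] : Type _ :=
  (Module.End K U)ᵐᵒᵖ

/-- The embedding `a ↦ a • id` of the centre `Z` of `K` in the endomorphism ring of `U`. -/
def centerEmbedding (K U : Type*) [DivisionRing K] [AddCommGroup U] [Module K U] :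
    Subring.center K →+* EndRight K U where
  toFun a := MulOpposite.op
    { toFun := fun u => (a : K) • u
      map_add' := smul_add _
      map_smul' := fun k u => by
        simp only [RingHom.id_apply, smul_smul]
        rw [Subring.mem_center_iff.1 a.2 k] }
  map_one' := by
    apply MulOpposite.unop_injective; ext u; simp
  map_mul' a b := by
    apply MulOpposite.unop_injective; ext u
    simp [smul_smul, Subring.mem_center_iff.1 b.2 (a : K)]
  map_zero' := by
    apply MulOpposite.unop_injective; ext u; simp
  map_add' a b := by
    apply MulOpposite.unop_injective; ext u; simp [add_smul]

/-- A permutation of the points is an automorphism of the distant graph if it preserves adjacency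
in both directions. -/
def IsDistantAut {S : Type*} [Ring S] (σ : Equiv.Perm (projLine S)) : Prop :=
  ∀ p q, (distantGraph S).Adj (σ p) (σ q) ↔ (distantGraph S).Adj p q

/-- A permutation of the points is an automorphism of the chain geometry if it preserves chains in
both directions. -/
def IsChainAut {F S : Type*} [Ring F] [Ring S] (φ : F →+* S)
    (σ : Equiv.Perm (projLine S)) : Prop :=
  ∀ C : Set (projLine S), σ '' C ∈ chains φ ↔ C ∈ chains φ

end ChainGeometry

/-! Encode the point R(a, b) by the subspace of U × U that is the range of u ↦ (ua, ub). On points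
this is injective, GL(2, R) acts as the automorphism group of U × U, and distant means complementary
(`distant_iff_isCompl`).

Chain automorphisms preserve adjacency because two distinct points are distant exactly when some
chain contains both (`distantGraph_adj_iff_exists_chain`).

For the other direction, chains are described by the distant relation alone. Modularity turns
`InPencil` into geometry: the three subspaces have a common join covering c and a common meet
(`ComplSubset.sup_eq`, `ComplSubset.inf_eq`); `complSubset_of_covBy` is a converse. Take A = R(0,
1), B = R(1, 0), W = R(1, 1); the points distant to A are the graphs of endomorphisms f. Then
`OnChain` asks that for each rank one a fixing a nonzero vector, some b equal to a or in its pencil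
with 0 makes b - f non-bijective. For a central homothety f, let b be a followed by f: it agrees
with f on the fixed vector. If some v is independent of vf, let a be a projection onto K(vf) that
kills v: every candidate b has range in K(vf) and kills v, so b - f is bijective. Hence f sends each
vector to a multiple of itself, and dimension > 1 makes it a central homothety. Transitivity of
GL(2, R) on triples of mutually distant points (`exists_movePerm_eq`) carries this to all chains
(`mem_chains_iff`). -/

namespace ChainGeometry

/-! ### Complements in modular lattices -/

section Lattice

variable {L : Type*} [Lattice L] [BoundedOrder L]

/-- Each complement of `c` is a complement of `a` or of `b`. -/
def ComplSubset (c a b : L) : Prop :=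
  ∀ x, IsCompl x c → IsCompl x a ∨ IsCompl x b

theorem ComplSubset.symm {c a b : L} (h : ComplSubset c a b) : ComplSubset c b a :=
  fun x hx => (h x hx).symm

variable [IsModularLattice L]

theorem not_lt_of_isCompl {x a c : L} (ha : IsCompl x a) (hc : IsCompl x c) : ¬ a < c := by
  intro h
  refine h.ne (eq_of_le_of_inf_le_of_sup_le (z := x) h.le ?_ ?_)
  · simp [hc.symm.inf_eq_bot]
  · simp [ha.symm.sup_eq_top]

/-- A complement x of c meets q in an atom, and x is a complement of any d ⋖ q not above that atom.
The atom cannot lie below both a and b, as it would then lie below c. -/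
theorem complSubset_of_covBy {c a b q : L} (hc : c ⋖ q) (ha : a ⋖ q) (hb : b ⋖ q)
    (hab : a ⊓ b ≤ c) : ComplSubset c a b := by
  intro x hx
  have hsup : c ⊔ x ⊓ q = q := by
    rw [← sup_inf_assoc_of_le x hc.le, hx.symm.sup_eq_top, top_inf_eq]
  have hinf : c ⊓ (x ⊓ q) = ⊥ := by
    rw [← inf_assoc, hx.symm.inf_eq_bot, bot_inf_eq]
  have hat : IsAtom (x ⊓ q) := by
    rw [← bot_covBy_iff, ← hinf]
    exact inf_covBy_of_covBy_sup_left (hsup.symm ▸ hc)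
  have key : ∀ {d : L}, d ⋖ q → ¬ x ⊓ q ≤ d → IsCompl x d := by
    intro d hd hxd
    have h1 : x ⊓ d = ⊥ := by
      have := (hat.not_le_iff_disjoint.1 hxd).eq_bot
      rwa [inf_assoc, inf_eq_right.2 hd.le] at this
    refine ⟨disjoint_iff.2 h1, codisjoint_iff.2 ?_⟩
    have h2 : q ≤ x ⊔ d := by
      rcases hd.eq_or_eq (le_sup_right : d ≤ x ⊓ q ⊔ d) (sup_le inf_le_right hd.le) with h | h
      · exact absurd (sup_eq_right.1 h) hxd
      · exact h ▸ sup_le_sup_right inf_le_left _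
    exact top_le_iff.1 (hx.sup_eq_top ▸ sup_le le_sup_left (hc.le.trans h2))
  by_cases h1 : x ⊓ q ≤ a
  · refine Or.inr (key hb fun h2 => hat.1 ?_)
    exact le_bot_iff.1 (hinf ▸ le_inf ((le_inf h1 h2).trans hab) le_rfl)
  · exact Or.inl (key ha h1)

variable [ComplementedLattice L]

/-- Every element is determined by the atoms below it. -/
def AtomsSeparate (L : Type*) [Lattice L] [BoundedOrder L] : Prop :=
  ∀ a c : L, ¬ a ≤ c → ∃ p, IsAtom p ∧ p ≤ a ∧ ¬ p ≤ c

/-- An atom below b but not below c would extend to a complement of c that meets b; so b ≤ c, and a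
common complement excludes b < c. -/
theorem AtomsSeparate.eq_of_forall_isCompl (hL : AtomsSeparate L) {b c : L}
    (h : ∀ x, IsCompl x c → IsCompl x b) : b = c := by
  have hbc : b ≤ c := by
    by_contra hbc
    obtain ⟨q, hq, hqb, hqc⟩ := hL b c hbc
    obtain ⟨x, hqx, hx⟩ := (hq.not_le_iff_disjoint.1 hqc).exists_isCompl
    exact hq.1 (le_bot_iff.1 ((h x hx).disjoint hqx hqb))
  obtain ⟨x, hx⟩ := exists_isCompl c
  exact hbc.eq_of_not_lt (not_lt_of_isCompl (h x hx.symm) hx.symm)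

theorem ComplSubset.not_le (hL : AtomsSeparate L) {c a b : L} (h : ComplSubset c a b)
    (hca : c ≠ a) (hcb : c ≠ b) : ¬ a ≤ c := by
  intro hac
  refine hcb (hL.eq_of_forall_isCompl fun x hx => ?_).symm
  exact (h x hx).resolve_left fun hxa =>
    not_lt_of_isCompl hxa hx (lt_of_le_of_ne hac hca.symm)

/-- Otherwise some atom q ≤ b is not below c ⊔ p. Then p ⊔ q is disjoint from c and extends to a
complement of c that meets both a and b. -/
theorem ComplSubset.le_sup_atom (hL : AtomsSeparate L) {c a b p : L} (h : ComplSubset c a b)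
    (hp : IsAtom p) (hpa : p ≤ a) (hpc : ¬ p ≤ c) : b ≤ c ⊔ p := by
  by_contra hb
  obtain ⟨q, hq, hqb, hqc⟩ := hL _ _ hb
  have h1 : Disjoint c (p ⊔ q) :=
    (hp.not_le_iff_disjoint.1 hpc).symm.disjoint_sup_right_of_disjoint_sup_left
      (hq.not_le_iff_disjoint.1 hqc).symm
  obtain ⟨x, hx, hxc⟩ := h1.symm.exists_isCompl
  rcases h x hxc with h2 | h2
  · exact hp.1 (le_bot_iff.1 (h2.disjoint (le_sup_left.trans hx) hpa))
  · exact hq.1 (le_bot_iff.1 (h2.disjoint (le_sup_right.trans hx) hqb))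

theorem ComplSubset.sup_eq (hL : AtomsSeparate L) {c a b : L} (h : ComplSubset c a b)
    (hca : c ≠ a) (hcb : c ≠ b) : c ⊔ a = c ⊔ b ∧ c ⋖ c ⊔ a := by
  obtain ⟨p, hp, hpa, hpc⟩ := hL _ _ (h.not_le hL hca hcb)
  obtain ⟨q, hq, hqb, hqc⟩ := hL _ _ (h.symm.not_le hL hcb hca)
  have hb := h.le_sup_atom hL hp hpa hpc
  have ha := h.symm.le_sup_atom hL hq hqb hqc
  have hpq : c ⊔ p = c ⊔ q :=
    le_antisymm (sup_le le_sup_left (hpa.trans ha)) (sup_le le_sup_left (hqb.trans hb))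
  have ha' : c ⊔ a = c ⊔ p :=
    le_antisymm (sup_le le_sup_left (hpq ▸ ha)) (sup_le_sup_left hpa _)
  have hb' : c ⊔ b = c ⊔ p :=
    le_antisymm (sup_le le_sup_left hb) (hpq ▸ sup_le_sup_left hqb _)
  refine ⟨ha'.trans hb'.symm, ha' ▸ ?_⟩
  refine covBy_sup_of_inf_covBy_right ?_
  rw [inf_comm, (hp.not_le_iff_disjoint.1 hpc).eq_bot]
  exact hp.bot_covBy

/-- Complements of atoms are coatoms. This allows the statement on joins to be dualized into one on
meets, `ComplSubset` being self-dual. -/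
theorem AtomsSeparate.orderDual (hL : AtomsSeparate L) : AtomsSeparate Lᵒᵈ := by
  intro a c hac
  obtain ⟨p, hp, hpc, hpa⟩ := hL (OrderDual.ofDual c) (OrderDual.ofDual a) hac
  obtain ⟨m, hm, hmp⟩ := (hp.not_le_iff_disjoint.1 hpa).symm.exists_isCompl
  refine ⟨OrderDual.toDual m, isAtom_dual_iff_isCoatom.2 (hmp.symm.isAtom_iff_isCoatom.1 hp),
    hm, fun h => hp.1 ?_⟩
  exact le_bot_iff.1 (hmp.disjoint (hpc.trans h) le_rfl)

theorem ComplSubset.inf_eq (hL : AtomsSeparate L) {c a b : L} (h : ComplSubset c a b)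
    (hca : c ≠ a) (hcb : c ≠ b) : c ⊓ a = c ⊓ b := by
  have h' : ComplSubset (L := Lᵒᵈ) (OrderDual.toDual c) (OrderDual.toDual a)
      (OrderDual.toDual b) := fun x hx =>
    (h (OrderDual.ofDual x) hx.ofDual).imp (fun h => h.dual) fun h => h.dual
  exact (h'.sup_eq hL.orderDual hca hcb).1

end Lattice

theorem atomsSeparate_submodule (K V : Type*) [DivisionRing K] [AddCommGroup V] [Module K V] :
    AtomsSeparate (Submodule K V) := by
  intro a c h
  obtain ⟨v, hva, hvc⟩ := SetLike.not_le_iff_exists.1 h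
  refine ⟨Submodule.span K {v}, nonzero_span_atom v ?_, by simpa using hva, by simpa using hvc⟩
  rintro rfl
  exact hvc c.zero_mem

/-! ### Points of the projective line as subspaces of U × U -/

section Subspaces

variable {K U : Type*} [DivisionRing K] [AddCommGroup U] [Module K U]

/-- The linear map `u ↦ (u a, u b)` defined by a row vector `(a, b)` over the endomorphism ring. -/
def rowMap (v : Fin 2 → EndRight K U) : U →ₗ[K] U × U :=
  (v 0).unop.prod (v 1).unop

@[simp]
theorem rowMap_apply (v : Fin 2 → EndRight K U) (u : U) :
    rowMap v u = ((v 0).unop u, (v 1).unop u) := rfl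

theorem rowMap_smul (r : EndRight K U) (v : Fin 2 → EndRight K U) :
    rowMap (r • v) = rowMap v ∘ₗ r.unop := by
  ext u <;> simp [rowMap]

/-- The linear map on `U × U` defined by a matrix over the endomorphism ring. -/
def matMap (g : Matrix (Fin 2) (Fin 2) (EndRight K U)) : U × U →ₗ[K] U × U :=
  (rowMap (g 0)).coprod (rowMap (g 1))

theorem rowMap_vecMul (v : Fin 2 → EndRight K U) (g : Matrix (Fin 2) (Fin 2) (EndRight K U)) :
    rowMap (Matrix.vecMul v g) = matMap g ∘ₗ rowMap v := by
  ext u <;> simp [rowMap, matMap, Matrix.vecMul, dotProduct, Fin.sum_univ_two]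

theorem matMap_mul (g h : Matrix (Fin 2) (Fin 2) (EndRight K U)) :
    matMap (g * h) = matMap h ∘ₗ matMap g := by
  unfold matMap
  rw [LinearMap.comp_coprod]
  simp only [Matrix.mul_apply_eq_vecMul, rowMap_vecMul, matMap]

theorem matMap_one : matMap (1 : Matrix (Fin 2) (Fin 2) (EndRight K U)) = LinearMap.id := by
  ext u <;> simp [matMap, rowMap]

theorem matMap_injective :
    Function.Injective (matMap : Matrix (Fin 2) (Fin 2) (EndRight K U) → _) := by
  intro g h hgh
  ext i j
  apply MulOpposite.unop_injective
  ext u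
  have h0 := LinearMap.congr_fun hgh (u, 0)
  have h1 := LinearMap.congr_fun hgh (0, u)
  simp only [matMap, rowMap_apply, LinearMap.coprod_apply, map_zero, add_zero, zero_add,
    Prod.mk.injEq] at h0 h1
  fin_cases i <;> fin_cases j <;> simp [h0, h1]

theorem matMap_surjective :
    Function.Surjective (matMap : Matrix (Fin 2) (Fin 2) (EndRight K U) → _) := by
  intro f
  refine ⟨!![.op (LinearMap.fst K U U ∘ₗ f ∘ₗ LinearMap.inl K U U),
    .op (LinearMap.snd K U U ∘ₗ f ∘ₗ LinearMap.inl K U U);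
    .op (LinearMap.fst K U U ∘ₗ f ∘ₗ LinearMap.inr K U U),
    .op (LinearMap.snd K U U ∘ₗ f ∘ₗ LinearMap.inr K U U)], ?_⟩
  ext u <;> simp [matMap, rowMap]

/-- The automorphism of `U × U` defined by an invertible matrix. -/
def glEquiv (g : GL2 (EndRight K U)) : (U × U) ≃ₗ[K] U × U :=
  LinearEquiv.ofLinearMap (matMap g.1) (matMap g⁻¹.1)
    (by rw [← matMap_mul, Units.inv_mul, matMap_one])
    (by rw [← matMap_mul, Units.mul_inv, matMap_one])

theorem glEquiv_surjective :
    Function.Surjective (glEquiv : GL2 (EndRight K U) → (U × U) ≃ₗ[K] U × U) := by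
  intro e
  obtain ⟨g, hg⟩ := matMap_surjective (e : U × U →ₗ[K] U × U)
  obtain ⟨h, hh⟩ := matMap_surjective (e.symm : U × U →ₗ[K] U × U)
  refine ⟨⟨g, h, matMap_injective ?_, matMap_injective ?_⟩, ?_⟩
  · rw [matMap_mul, hg, hh, matMap_one]; ext <;> simp
  · rw [matMap_mul, hg, hh, matMap_one]; ext <;> simp
  · ext x : 1
    exact LinearMap.congr_fun hg x

/-- The subspace of `U × U` defined by a submodule of `R²`. -/
def subspace (p : Submodule (EndRight K U) (Fin 2 → EndRight K U)) : Submodule K (U × U) :=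
  ⨆ v ∈ p, LinearMap.range (rowMap v)

theorem subspace_cyclic (a b : EndRight K U) :
    subspace (cyclic a b) = LinearMap.range (rowMap ![a, b]) := by
  refine le_antisymm (iSup₂_le fun v hv => ?_)
    (le_iSup₂_of_le _ (Submodule.mem_span_singleton_self _) le_rfl)
  obtain ⟨r, rfl⟩ := Submodule.mem_span_singleton.1 hv
  rw [rowMap_smul]
  exact LinearMap.range_comp_le_range _ _

theorem subspace_moveSubmodule (g : GL2 (EndRight K U))
    (p : Submodule (EndRight K U) (Fin 2 → EndRight K U)) :
    subspace (moveSubmodule g p) = (subspace p).map (glEquiv g : U × U →ₗ[K] U × U) := by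
  have h : ∀ v, LinearMap.range (rowMap (Matrix.vecMul v g.1)) =
      (LinearMap.range (rowMap v)).map (glEquiv g : U × U →ₗ[K] U × U) := fun v => by
    rw [rowMap_vecMul, LinearMap.range_comp]; rfl
  simp only [subspace, Submodule.map_iSup, ← h]
  refine le_antisymm (iSup₂_le fun v hv => ?_) (iSup₂_le fun v hv => ?_)
  · obtain ⟨w, hw, rfl⟩ := hv
    exact le_iSup₂_of_le (f := fun v _ => LinearMap.range (rowMap (Matrix.vecMul v g.1))) w hw le_rfl
  · exact le_iSup₂_of_le (f := fun v _ => LinearMap.range (rowMap v)) _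
      (Submodule.mem_map_of_mem hv) le_rfl

/-- Since U is projective, a map whose range lies in that of `rowMap ![a, b]` factors through it;
the factor is the required coefficient in R. -/
theorem mem_cyclic_iff {a b : EndRight K U} {v : Fin 2 → EndRight K U} :
    v ∈ cyclic a b ↔ LinearMap.range (rowMap v) ≤ LinearMap.range (rowMap ![a, b]) := by
  refine ⟨fun hv => ?_, fun h => ?_⟩
  · obtain ⟨r, rfl⟩ := Submodule.mem_span_singleton.1 hv
    rw [rowMap_smul]
    exact LinearMap.range_comp_le_range _ _
  · obtain ⟨r, hr⟩ := Module.projective_lifting_property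
      (rowMap ![a, b]).rangeRestrict
      ((rowMap v).codRestrict _ fun u => h ⟨u, rfl⟩) (LinearMap.surjective_rangeRestrict _)
    refine Submodule.mem_span_singleton.2 ⟨.op r, ?_⟩
    have h1 : ∀ u, rowMap ![a, b] (r u) = rowMap v u := fun u =>
      congrArg Subtype.val (LinearMap.congr_fun hr u)
    funext i
    apply MulOpposite.unop_injective
    ext u
    have := h1 u
    simp only [rowMap_apply, Prod.mk.injEq] at this
    fin_cases i
    · exact this.1
    · exact this.2

theorem cyclic_eq_iff {a b c d : EndRight K U} :
    cyclic a b = cyclic c d ↔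
      LinearMap.range (rowMap ![a, b]) = LinearMap.range (rowMap ![c, d]) := by
  refine ⟨fun h => by rw [← subspace_cyclic, h, subspace_cyclic], fun h => ?_⟩
  ext v
  rw [mem_cyclic_iff, mem_cyclic_iff, h]

theorem exists_eq_cyclic {S : Type*} [Ring S] (p : projLine S) : ∃ a b, p.1 = cyclic a b := by
  obtain ⟨g, hg⟩ := p.2
  exact ⟨_, _, hg.trans (moveSubmodule_cyclic g 1 0)⟩

theorem subspace_injective {p q : projLine (EndRight K U)} (h : subspace p.1 = subspace q.1) :
    p = q := by
  obtain ⟨a, b, hp⟩ := exists_eq_cyclic p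
  obtain ⟨c, d, hq⟩ := exists_eq_cyclic q
  rw [hp, hq, subspace_cyclic, subspace_cyclic] at h
  exact Subtype.ext (by rw [hp, hq, cyclic_eq_iff.2 h])

theorem subspace_one_zero :
    subspace (cyclic (1 : EndRight K U) 0) = LinearMap.range (LinearMap.inl K U U) := by
  rw [subspace_cyclic]
  congr 1

theorem subspace_zero_one :
    subspace (cyclic (0 : EndRight K U) 1) = LinearMap.range (LinearMap.inr K U U) := by
  rw [subspace_cyclic]
  congr 1

theorem isCompl_inl_inr :
    IsCompl (LinearMap.range (LinearMap.inl K U U)) (LinearMap.range (LinearMap.inr K U U)) :=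
  LinearMap.isCompl_range_inl_inr

theorem Distant.isCompl {p q : projLine (EndRight K U)} (h : Distant p q) :
    IsCompl (subspace p.1) (subspace q.1) := by
  obtain ⟨g, hp, hq⟩ := h
  rw [hp, hq, subspace_moveSubmodule, subspace_moveSubmodule, subspace_one_zero,
    subspace_zero_one]
  exact isCompl_inl_inr.map (Submodule.orderIsoMapComap (glEquiv g))

/-- Every complement of the subspace of a point is the subspace of a point distant to it. -/
theorem exists_distant {p : projLine (EndRight K U)} {Y : Submodule K (U × U)}
    (h : IsCompl (subspace p.1) Y) : ∃ q, Distant p q ∧ subspace q.1 = Y := by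
  obtain ⟨g, hg⟩ := p.2
  set X := subspace p.1 with hX
  have hX' : X = (LinearMap.range (LinearMap.inl K U U)).map (glEquiv g : U × U →ₗ[K] U × U) := by
    rw [hX, hg, subspace_moveSubmodule, subspace_one_zero]
  set Y' := (LinearMap.range (LinearMap.inr K U U)).map (glEquiv g : U × U →ₗ[K] U × U)
  have hXY' : IsCompl X Y' := by
    rw [hX']; exact isCompl_inl_inr.map (Submodule.orderIsoMapComap (glEquiv g))
  -- Two complements of X are isomorphic through the quotient by X. Gluing this to the identity of X
  -- yields an automorphism that agrees with g on U × 0 and takes 0 × U to Y.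
  let eY : Y' ≃ₗ[K] Y :=
    (Submodule.quotientEquivOfIsCompl X Y' hXY').symm ≪≫ₗ Submodule.quotientEquivOfIsCompl X Y h
  let e : (U × U) ≃ₗ[K] U × U :=
    glEquiv g ≪≫ₗ (Submodule.prodEquivOfIsCompl X Y' hXY').symm ≪≫ₗ
      (LinearEquiv.refl K X).prodCongr eY ≪≫ₗ Submodule.prodEquivOfIsCompl X Y h
  have heX : ∀ u, e (u, 0) = glEquiv g (u, 0) := by
    intro u
    have hm : glEquiv g (u, 0) ∈ X := by
      rw [hX']; exact ⟨(u, 0), ⟨u, rfl⟩, rfl⟩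
    have : (Submodule.prodEquivOfIsCompl X Y' hXY').symm (glEquiv g (u, 0)) =
        (⟨_, hm⟩, 0) := Submodule.prodEquivOfIsCompl_symm_apply_left X Y' hXY' ⟨_, hm⟩
    simp [e, this]
  have heY : ∀ u, ∃ hm : glEquiv g (0, u) ∈ Y', e (0, u) = eY ⟨_, hm⟩ := by
    intro u
    have hm : glEquiv g (0, u) ∈ Y' := ⟨(0, u), ⟨u, rfl⟩, rfl⟩
    have : (Submodule.prodEquivOfIsCompl X Y' hXY').symm (glEquiv g (0, u)) =
        (0, ⟨_, hm⟩) := Submodule.prodEquivOfIsCompl_symm_apply_right X Y' hXY' ⟨_, hm⟩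
    exact ⟨hm, by simp [e, this]⟩
  obtain ⟨k, hk⟩ := glEquiv_surjective e
  have hq : subspace (moveSubmodule k (cyclic 0 1)) = Y := by
    rw [subspace_moveSubmodule, subspace_zero_one, hk]
    apply le_antisymm
    · rintro _ ⟨_, ⟨u, rfl⟩, rfl⟩
      obtain ⟨hm, h1⟩ := heY u
      exact h1 ▸ (eY ⟨_, hm⟩).2
    · intro y hy
      obtain ⟨⟨y', hy'⟩, h1⟩ := eY.surjective ⟨y, hy⟩
      obtain ⟨_, ⟨u, rfl⟩, rfl⟩ := hy'
      obtain ⟨hm, h2⟩ := heY u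
      refine ⟨(0, u), ⟨u, rfl⟩, ?_⟩
      exact h2.trans (congrArg Subtype.val h1)
  have hp : subspace (moveSubmodule k (cyclic 1 0)) = X := by
    rw [subspace_moveSubmodule, subspace_one_zero, hk, hX']
    apply le_antisymm
    · rintro _ ⟨_, ⟨u, rfl⟩, rfl⟩
      exact ⟨(u, 0), ⟨u, rfl⟩, (heX u).symm⟩
    · rintro _ ⟨_, ⟨u, rfl⟩, rfl⟩
      exact ⟨(u, 0), ⟨u, rfl⟩, heX u⟩
  have hmem : moveSubmodule k (cyclic 0 1) ∈ projLine (EndRight K U) := by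
    refine ⟨swapMatrix _ * k, ?_⟩
    rw [moveSubmodule_mul, moveSubmodule_cyclic (swapMatrix _)]
    simp [swapMatrix]
  refine ⟨⟨_, hmem⟩, ⟨k, ?_, rfl⟩, hq⟩
  exact congrArg Subtype.val
    (subspace_injective (p := p) (q := ⟨moveSubmodule k (cyclic 1 0), k, rfl⟩) hp.symm)

theorem distant_iff_isCompl {p q : projLine (EndRight K U)} :
    Distant p q ↔ IsCompl (subspace p.1) (subspace q.1) := by
  refine ⟨Distant.isCompl, fun h => ?_⟩
  obtain ⟨q', hd, hq'⟩ := exists_distant h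
  exact subspace_injective hq' ▸ hd

end Subspaces

/-! ### Graphs of endomorphisms and maps of rank one -/

section Graphs

variable {K U : Type*} [DivisionRing K] [AddCommGroup U] [Module K U]

theorem isCompl_graph_iff {f g : Module.End K U} :
    IsCompl f.graph g.graph ↔ Function.Bijective (f - g) := by
  constructor
  · intro h
    refine ⟨(injective_iff_map_eq_zero _).2 fun u hu => ?_, fun v => ?_⟩
    · have h1 : (u, f u) ∈ f.graph ⊓ g.graph :=
        ⟨by simp, by simpa [LinearMap.mem_graph_iff] using sub_eq_zero.1 hu⟩
      rw [h.inf_eq_bot] at h1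
      simpa using (congrArg Prod.fst ((Submodule.mem_bot K).1 h1))
    · obtain ⟨x, hx, y, hy, hxy⟩ := Submodule.mem_sup.1
        (h.sup_eq_top ▸ Submodule.mem_top : ((0, v) : U × U) ∈ f.graph ⊔ g.graph)
      rw [LinearMap.mem_graph_iff] at hx hy
      have h1 : x.1 + y.1 = 0 := congrArg Prod.fst hxy
      have h2 : x.2 + y.2 = v := congrArg Prod.snd hxy
      refine ⟨x.1, ?_⟩
      rw [LinearMap.sub_apply, ← hx, ← h2, eq_neg_of_add_eq_zero_left h1, map_neg, ← hy]
      abel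
  · rintro ⟨hi, hs⟩
    refine ⟨Submodule.disjoint_def.2 fun x hx hy => ?_, codisjoint_iff_le_sup.2 fun x _ => ?_⟩
    · rw [LinearMap.mem_graph_iff] at hx hy
      have h1 : x.1 = 0 := hi (by simp [← hx, ← hy])
      exact Prod.ext h1 (by simp [hx, h1])
    · obtain ⟨u, hu⟩ := hs (x.2 - g x.1)
      refine Submodule.mem_sup.2 ⟨(u, f u), by simp, (x.1 - u, g (x.1 - u)), by simp, ?_⟩
      rw [LinearMap.sub_apply] at hu
      refine Prod.ext (by simp) ?_
      rw [Prod.snd_add, map_sub, sub_eq_iff_eq_add.1 hu.symm]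
      dsimp only
      abel

theorem isCompl_graph_inr (f : Module.End K U) :
    IsCompl f.graph (LinearMap.range (LinearMap.inr K U U)) := by
  refine ⟨Submodule.disjoint_def.2 ?_, codisjoint_iff_le_sup.2 fun x _ => ?_⟩
  · rintro _ hx ⟨v, rfl⟩
    rw [LinearMap.mem_graph_iff] at hx
    simpa using hx
  · exact Submodule.mem_sup.2 ⟨(x.1, f x.1), by simp, (0, x.2 - f x.1), ⟨_, rfl⟩,
      Prod.ext (by simp) (by simp)⟩

theorem exists_eq_graph_of_isCompl {X : Submodule K (U × U)}
    (h : IsCompl X (LinearMap.range (LinearMap.inr K U U))) :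
    ∃ f : Module.End K U, X = f.graph := by
  refine Submodule.exists_eq_graph ⟨fun x y hxy => ?_, fun u => ?_⟩
  · have h1 : (x - y : U × U) ∈ X ⊓ LinearMap.range (LinearMap.inr K U U) := by
      refine ⟨X.sub_mem x.2 y.2, (x - y : U × U).2, Prod.ext ?_ rfl⟩
      exact (sub_eq_zero.2 hxy).symm
    rw [h.inf_eq_bot, Submodule.mem_bot, sub_eq_zero] at h1
    exact Subtype.ext h1
  · obtain ⟨x, hx, y, ⟨v, rfl⟩, hxy⟩ := Submodule.mem_sup.1
        (h.sup_eq_top ▸ Submodule.mem_top : ((u, 0) : U × U) ∈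
          X ⊔ LinearMap.range (LinearMap.inr K U U))
    exact ⟨⟨x, hx⟩, by simpa using congrArg Prod.fst hxy⟩

theorem graph_injective :
    Function.Injective (LinearMap.graph : Module.End K U → Submodule K (U × U)) := by
  intro f g h
  ext u
  have : (u, f u) ∈ g.graph := h ▸ (by simp : (u, f u) ∈ f.graph)
  simpa [LinearMap.mem_graph_iff] using this

theorem graph_covBy {f : Module.End K U} {w : U} (hw : w ≠ 0)
    (hf : ∀ u, f u ∈ Submodule.span K {w}) :
    f.graph ⋖ Submodule.prod ⊤ (Submodule.span K {w}) := by
  have h1 : ((0, w) : U × U) ∉ f.graph := by simpa [LinearMap.mem_graph_iff] using hw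
  have h2 : Submodule.span K {((0, w) : U × U)} ⊔ f.graph =
      Submodule.prod ⊤ (Submodule.span K {w}) := by
    apply le_antisymm
    · refine sup_le ?_ fun x hx => ?_
      · simp [Submodule.mem_span_singleton_self]
      · rw [LinearMap.mem_graph_iff] at hx
        exact ⟨trivial, hx ▸ hf _⟩
    · rintro ⟨x, y⟩ ⟨-, hy⟩
      obtain ⟨t, ht⟩ := Submodule.mem_span_singleton.1 (Submodule.sub_mem _ hy (hf x))
      refine Submodule.mem_sup.2 ⟨t • (0, w), Submodule.smul_mem _ _
        (Submodule.mem_span_singleton_self _), (x, f x), by simp, ?_⟩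
      simp [ht]
  exact h2 ▸ Submodule.covBy_span_singleton_sup h1

/-- The join is U × (range of a), so the covering relation makes the range a line Kw. If aw = kw
with k ≠ 1, then a - 1 can be inverted explicitly. -/
theorem exists_fixed_of_graph_covBy {a : Module.End K U}
    (h : (0 : Module.End K U).graph ⋖ (0 : Module.End K U).graph ⊔ a.graph)
    (h1 : ¬ Function.Bijective (a - 1 : Module.End K U)) :
    ∃ w, w ≠ 0 ∧ a w = w ∧ ∀ u, a u ∈ Submodule.span K {w} := by
  have h0 : ∃ u, a u ≠ 0 := by
    by_contra! h0
    obtain rfl : a = 0 := LinearMap.ext h0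
    simp at h
  obtain ⟨u₀, hu₀⟩ := h0
  set w := a u₀ with hw
  have hle : (0 : Module.End K U).graph ⊔ a.graph ≤ Submodule.prod ⊤ (Submodule.span K {w}) := by
    have h2 : (0 : Module.End K U).graph ⋖ Submodule.prod ⊤ (Submodule.span K {w}) :=
      graph_covBy hu₀ (by simp)
    have h3 : Submodule.prod ⊤ (Submodule.span K {w}) ≤
        (0 : Module.End K U).graph ⊔ a.graph := by
      rintro ⟨x, y⟩ ⟨-, hy⟩
      obtain ⟨t, rfl⟩ := Submodule.mem_span_singleton.1 hy
      refine Submodule.mem_sup.2 ⟨(x - t • u₀, 0), by simp [LinearMap.mem_graph_iff],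
        (t • u₀, t • w), by simp [LinearMap.mem_graph_iff, hw], by simp⟩
    rcases h.eq_or_eq h2.le h3 with h4 | h4
    · exact absurd h4 h2.ne'
    · exact h4.ge
  have hr : ∀ u, a u ∈ Submodule.span K {w} := fun u =>
    (hle (Submodule.mem_sup_right (by simp : (u, a u) ∈ a.graph))).2
  refine ⟨w, hu₀, ?_, hr⟩
  obtain ⟨k, hk⟩ := Submodule.mem_span_singleton.1 (hr w)
  by_contra hne
  have hk1 : k - 1 ≠ 0 := by
    intro h
    rw [sub_eq_zero.1 h, one_smul] at hk
    exact hne hk.symm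
  refine h1 ⟨(injective_iff_map_eq_zero _).2 fun u hu => ?_, fun v => ?_⟩
  · have hu' : a u = u := by simpa [sub_eq_zero] using hu
    obtain ⟨c, hc⟩ := Submodule.mem_span_singleton.1 (hr u)
    have h5 : (c * (k - 1)) • w = 0 := by
      rw [mul_sub, sub_smul, mul_smul, hk, ← map_smul, hc, hu', mul_one, hc, hu', sub_self]
    have h6 : c = 0 := by simpa [hk1, hu₀] using h5
    rw [← hu', ← hc, h6, zero_smul]
  · obtain ⟨d, hd⟩ := Submodule.mem_span_singleton.1 (hr v)
    -- The ansatz s • w - v is sent by a - 1 to s(k - 1)w - dw + v, which determines s.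
    refine ⟨(d * (k - 1)⁻¹) • w - v, ?_⟩
    have h5 : (d * (k - 1)⁻¹) • (k • w - w) = a v := by
      rw [← hd]
      nth_rewrite 2 [← one_smul K w]
      rw [← sub_smul, smul_smul, mul_assoc, inv_mul_cancel₀ hk1, mul_one]
    rw [LinearMap.sub_apply, map_sub, map_smul, Module.End.one_apply, ← hk, sub_sub_sub_comm,
      ← smul_sub, h5, sub_sub_cancel]

/-- The range of `u ↦ (u - u e, u e)`. -/
def skewRange (e : Module.End K U) : Submodule K (U × U) :=
  LinearMap.range ((1 - e).prod e)

theorem mem_skewRange {e : Module.End K U} {x : U × U} :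
    x ∈ skewRange e ↔ ∃ u, u - e u = x.1 ∧ e u = x.2 := by
  simp [skewRange, Prod.ext_iff]

theorem skewRange_covBy {e : Module.End K U} {w : U} (hw : w ≠ 0) (hew : e w = w)
    (he : ∀ u, e u ∈ Submodule.span K {w}) :
    skewRange e ⋖ Submodule.prod ⊤ (Submodule.span K {w}) := by
  have hee : ∀ u, e (e u) = e u := fun u => by
    obtain ⟨t, ht⟩ := Submodule.mem_span_singleton.1 (he u)
    rw [← ht, map_smul, hew]
  have h1 : ((w, 0) : U × U) ∉ skewRange e := by
    rw [mem_skewRange]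
    rintro ⟨u, h1, h2⟩
    simp only [h2, sub_zero] at h1
    exact hw (by rw [← hew, ← h1, h2])
  have h2 : Submodule.span K {((w, 0) : U × U)} ⊔ skewRange e =
      Submodule.prod ⊤ (Submodule.span K {w}) := by
    apply le_antisymm
    · refine sup_le ?_ fun x hx => ?_
      · simp
      · obtain ⟨u, -, h⟩ := mem_skewRange.1 hx
        exact ⟨trivial, h ▸ he _⟩
    · rintro ⟨x, y⟩ ⟨-, hy⟩
      obtain ⟨t, rfl⟩ := Submodule.mem_span_singleton.1 hy
      obtain ⟨s, hs⟩ := Submodule.mem_span_singleton.1 (he x)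
      refine Submodule.mem_sup.2 ⟨s • (w, 0), Submodule.smul_mem _ _
        (Submodule.mem_span_singleton_self _), (x - e x, t • w),
        mem_skewRange.2 ⟨x - e x + t • w, ?_, ?_⟩, ?_⟩
      all_goals simp [hee, hew, hs]
  exact h2 ▸ Submodule.covBy_span_singleton_sup h1

end Graphs

/-! ### Pencils and chains in terms of a binary relation -/

section Relation

variable {P : Type*} (D : P → P → Prop)

/-- The three points `c`, `a`, `b` are distinct, and all that is related to `c` is related to
`a` or to `b`. -/
def InPencil (c a b : P) : Prop :=
  c ≠ a ∧ c ≠ b ∧ a ≠ b ∧ ∀ x, D x c → D x a ∨ D x b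

/-- A description of the chain through three points in terms of the relation `D` only. -/
def OnChain (A B W X : P) : Prop :=
  X = A ∨ X = B ∨ (D X A ∧ D X B ∧ ∀ α, (∃ γ, InPencil D B α γ) → D α A → ¬ D α W →
    ∃ β, (β = α ∨ InPencil D B α β) ∧ D β A ∧ ¬ D β X)

variable {D} {σ : Equiv.Perm P}

theorem inPencil_perm_iff (hσ : ∀ p q, D (σ p) (σ q) ↔ D p q) {c a b : P} :
    InPencil D (σ c) (σ a) (σ b) ↔ InPencil D c a b := by
  refine and_congr σ.injective.ne_iff (and_congr σ.injective.ne_iff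
    (and_congr σ.injective.ne_iff (σ.surjective.forall.trans (forall_congr' fun x => ?_))))
  rw [hσ, hσ, hσ]

theorem onChain_perm_iff (hσ : ∀ p q, D (σ p) (σ q) ↔ D p q) {A B W X : P} :
    OnChain D (σ A) (σ B) (σ W) (σ X) ↔ OnChain D A B W X := by
  refine or_congr σ.injective.eq_iff (or_congr σ.injective.eq_iff (and_congr (hσ _ _)
    (and_congr (hσ _ _) (σ.surjective.forall.trans (forall_congr' fun α => imp_congr
      (σ.surjective.exists.trans (exists_congr fun γ => inPencil_perm_iff hσ))
      (imp_congr (hσ _ _) (imp_congr (not_congr (hσ _ _))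
        (σ.surjective.exists.trans (exists_congr fun β => ?_)))))))))
  rw [σ.injective.eq_iff, inPencil_perm_iff hσ, hσ, hσ]

theorem image_onChain (hσ : ∀ p q, D (σ p) (σ q) ↔ D p q) (A B W : P) :
    σ '' {X | OnChain D A B W X} = {X | OnChain D (σ A) (σ B) (σ W) X} := by
  ext X
  obtain ⟨X, rfl⟩ := σ.surjective X
  simp [onChain_perm_iff hσ]

end Relation

/-! ### Special points and the action of GL(2, S) -/

section Points

variable {S : Type*} [Ring S]

theorem cyclic_one_mem_projLine (s : S) : cyclic 1 s ∈ projLine S := by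
  refine ⟨⟨!![1, s; 0, 1], !![1, -s; 0, 1], by simp [Matrix.one_fin_two],
    by simp [Matrix.one_fin_two]⟩, ?_⟩
  rw [moveSubmodule_cyclic]
  simp

theorem cyclic_zero_one_mem_projLine : cyclic (0 : S) 1 ∈ projLine S := by
  refine ⟨swapMatrix S, ?_⟩
  rw [moveSubmodule_cyclic]
  simp [swapMatrix]

/-- The matrix with rows (1 - e, e) and (e, 1 - e) is its own inverse. -/
theorem cyclic_mem_projLine_of_isIdempotentElem {e : S} (he : IsIdempotentElem e) :
    cyclic (1 - e) e ∈ projLine S := by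
  have h : !![1 - e, e; e, 1 - e] * !![1 - e, e; e, 1 - e] = 1 := by
    simp [Matrix.one_fin_two, he.eq, he.one_sub.eq, he.mul_one_sub_self, he.one_sub_mul_self]
  refine ⟨⟨_, _, h, h⟩, ?_⟩
  rw [moveSubmodule_cyclic]
  simp

theorem cyclic_zero_zero_notMem_projLine [Nontrivial S] : cyclic (0 : S) 0 ∉ projLine S := by
  rintro ⟨g, hg⟩
  have h0 : cyclic (0 : S) 0 = ⊥ := by
    simp [cyclic]
  rw [h0, moveSubmodule_cyclic] at hg
  simp only [one_mul, zero_mul, add_zero, cyclic, eq_comm (a := (⊥ : Submodule S _)),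
    Submodule.span_singleton_eq_bot] at hg
  have h1 := congrFun hg 0
  have h2 := congrFun hg 1
  have h3 := congrFun (congrFun (Units.mul_inv g) 0) 0
  simp only [Matrix.cons_val_zero, Matrix.cons_val_one, Pi.zero_apply] at h1 h2
  simp [Matrix.mul_apply, Fin.sum_univ_two, h1, h2] at h3

theorem cyclic_mul_left_of_isUnit {u : S} (hu : IsUnit u) (a b : S) :
    cyclic (u * a) (u * b) = cyclic a b := by
  obtain ⟨u, rfl⟩ := hu
  have : ![(u : S) * a, (u : S) * b] = u • ![a, b] := by
    ext i; fin_cases i <;> simp [Units.smul_def]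
  rw [cyclic, this]
  exact Submodule.span_singleton_group_smul_eq S u _

/-- The point `S(0, 1)`. -/
def infPoint (S : Type*) [Ring S] : projLine S := ⟨cyclic 0 1, cyclic_zero_one_mem_projLine⟩

/-- The point `S(1, s)`. -/
def affinePoint (s : S) : projLine S := ⟨cyclic 1 s, cyclic_one_mem_projLine s⟩

theorem moveSubmodule_one (p : Submodule S (Fin 2 → S)) : moveSubmodule 1 p = p := by
  have : Matrix.vecMulLinear ((1 : GL2 S) : Matrix (Fin 2) (Fin 2) S) = LinearMap.id :=
    LinearMap.ext fun v => by simp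
  rw [moveSubmodule, this, Submodule.map_id]

/-- The permutation of the points that is defined by an invertible matrix. -/
def movePerm (g : GL2 S) : Equiv.Perm (projLine S) where
  toFun := movePoint g
  invFun := movePoint g⁻¹
  left_inv p := by
    apply Subtype.ext
    change moveSubmodule g⁻¹ (moveSubmodule g p.1) = p.1
    rw [← moveSubmodule_mul, mul_inv_cancel, moveSubmodule_one]
  right_inv p := by
    apply Subtype.ext
    change moveSubmodule g (moveSubmodule g⁻¹ p.1) = p.1
    rw [← moveSubmodule_mul, inv_mul_cancel, moveSubmodule_one]

theorem Distant.movePoint {p q : projLine S} (h : Distant p q) (g : GL2 S) :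
    Distant (movePoint g p) (movePoint g q) := by
  obtain ⟨k, hp, hq⟩ := h
  refine ⟨k * g, ?_, ?_⟩
  · rw [moveSubmodule_mul, ← hp]; rfl
  · rw [moveSubmodule_mul, ← hq]; rfl

theorem distant_movePerm_iff (g : GL2 S) (p q : projLine S) :
    Distant (movePerm g p) (movePerm g q) ↔ Distant p q := by
  refine ⟨fun h => ?_, fun h => h.movePoint g⟩
  have := h.movePoint g⁻¹
  rwa [show ChainGeometry.movePoint g⁻¹ (movePerm g p) = p from (movePerm g).left_inv p,
    show ChainGeometry.movePoint g⁻¹ (movePerm g q) = q from (movePerm g).left_inv q] at this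

end Points

/-! ### The standard chain described by the distant relation -/

section Chain

variable {K U : Type*} [DivisionRing K] [AddCommGroup U] [Module K U]

theorem subspace_affinePoint (f : EndRight K U) :
    subspace (affinePoint f).1 = f.unop.graph := by
  rw [affinePoint, subspace_cyclic, LinearMap.graph_eq_range_prod]
  congr 1

theorem subspace_infPoint :
    subspace (infPoint (EndRight K U)).1 = LinearMap.range (LinearMap.inr K U U) :=
  subspace_zero_one

theorem distant_affinePoint_infPoint (f : EndRight K U) :
    Distant (affinePoint f) (infPoint _) := by
  rw [distant_iff_isCompl, subspace_affinePoint, subspace_infPoint]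
  exact isCompl_graph_inr _

theorem exists_eq_affinePoint {p : projLine (EndRight K U)} (h : Distant p (infPoint _)) :
    ∃ f, p = affinePoint f := by
  rw [distant_iff_isCompl, subspace_infPoint] at h
  obtain ⟨f, hf⟩ := exists_eq_graph_of_isCompl h
  exact ⟨.op f, subspace_injective (by rw [hf, subspace_affinePoint, MulOpposite.unop_op])⟩

theorem distant_affinePoint_iff {f g : EndRight K U} :
    Distant (affinePoint f) (affinePoint g) ↔ Function.Bijective (f.unop - g.unop) := by
  rw [distant_iff_isCompl, subspace_affinePoint, subspace_affinePoint, isCompl_graph_iff]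

theorem affinePoint_injective : Function.Injective (affinePoint : EndRight K U → _) := by
  intro f g h
  have := congrArg (fun p => subspace p.1) h
  simp only [subspace_affinePoint] at this
  exact MulOpposite.unop_injective (graph_injective this)

/-- By `exists_distant`, every complement of the subspace of a point comes from a point, so it does
not matter whether x runs over points or over subspaces. -/
theorem inPencil_iff {c a b : projLine (EndRight K U)} :
    InPencil Distant c a b ↔ c ≠ a ∧ c ≠ b ∧ a ≠ b ∧
      ComplSubset (subspace c.1) (subspace a.1) (subspace b.1) := by
  unfold InPencil ComplSubset
  simp only [distant_iff_isCompl]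
  refine and_congr_right fun _ => and_congr_right fun _ => and_congr_right fun _ =>
    ⟨fun h X hX => ?_, fun h x => h _⟩
  obtain ⟨x, -, rfl⟩ := exists_distant hX.symm
  exact h x hX

/-- The centre is a field, so a nonzero first coordinate can be normalized to 1. -/
theorem mem_standardChain_iff {p : projLine (EndRight K U)} :
    p ∈ standardChain (centerEmbedding K U) ↔
      p = infPoint _ ∨ ∃ z, p = affinePoint (centerEmbedding K U z) := by
  constructor
  · rintro ⟨a, b, hab, hp⟩
    by_cases ha : a = 0
    · subst ha
      have hb : b ≠ 0 := by
        rintro rfl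
        exact cyclic_zero_zero_notMem_projLine hab
      refine Or.inl (Subtype.ext ?_)
      rw [hp]
      have := cyclic_mul_left_of_isUnit ((isUnit_iff_ne_zero.2 hb).map (centerEmbedding K U)) 0 1
      simpa [infPoint] using this
    · refine Or.inr ⟨a⁻¹ * b, Subtype.ext ?_⟩
      rw [hp]
      have := cyclic_mul_left_of_isUnit ((isUnit_iff_ne_zero.2 ha).map (centerEmbedding K U)) 1
        (centerEmbedding K U (a⁻¹ * b))
      rw [← map_mul, mul_inv_cancel_left₀ ha, mul_one] at this
      exact this
  · rintro (rfl | ⟨z, rfl⟩)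
    · exact ⟨0, 1, cyclic_zero_one_mem_projLine, by simp [infPoint]⟩
    · exact ⟨1, z, cyclic_one_mem_projLine z, by simp [affinePoint]⟩

theorem centerEmbedding_apply (z : Subring.center K) (u : U) :
    (centerEmbedding K U z).unop u = (z : K) • u := rfl

theorem distant_of_center_ne {y z : Subring.center K} (h : y ≠ z) :
    Distant (affinePoint (centerEmbedding K U y)) (affinePoint (centerEmbedding K U z)) := by
  rw [distant_affinePoint_iff, ← MulOpposite.unop_sub, ← map_sub]
  have h' : ((y - z : Subring.center K) : K) ≠ 0 := fun h0 => h (sub_eq_zero.1 (Subtype.ext h0))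
  refine ⟨fun u v huv => smul_right_injective U h' huv,
    fun v => ⟨((y - z : Subring.center K) : K)⁻¹ • v, ?_⟩⟩
  rw [centerEmbedding_apply, smul_inv_smul₀ h']

theorem onChain_of_mem_standardChain {p : projLine (EndRight K U)}
    (hp : p ∈ standardChain (centerEmbedding K U)) :
    OnChain Distant (infPoint _) (affinePoint 0) (affinePoint 1) p := by
  rcases mem_standardChain_iff.1 hp with rfl | ⟨z, rfl⟩
  · exact Or.inl rfl
  by_cases hz : z = 0
  · exact Or.inr (Or.inl (by rw [hz, map_zero]))
  have hz' : (z : K) ≠ 0 := fun h => hz (Subtype.ext h)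
  refine Or.inr (Or.inr ⟨distant_affinePoint_infPoint _, ?_, ?_⟩)
  · rw [← map_zero (centerEmbedding K U)]
    exact distant_of_center_ne hz
  rintro α ⟨γ, hγ⟩ hα hα1
  obtain ⟨a, rfl⟩ := exists_eq_affinePoint hα
  rw [inPencil_iff] at hγ
  obtain ⟨h1, h2, h3, h4⟩ := hγ
  have hcov := (h4.sup_eq (atomsSeparate_submodule K (U × U))
    (fun h => h1 (subspace_injective h)) (fun h => h2 (subspace_injective h))).2
  rw [subspace_affinePoint, subspace_affinePoint, MulOpposite.unop_zero] at hcov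
  rw [distant_affinePoint_iff, MulOpposite.unop_one] at hα1
  obtain ⟨w, hw, haw, ha⟩ := exists_fixed_of_graph_covBy hcov hα1
  have hza : ∀ u, (a * centerEmbedding K U z).unop u = (z : K) • a.unop u := fun u => rfl
  have hnot : ¬ Distant (affinePoint (a * centerEmbedding K U z))
      (affinePoint (centerEmbedding K U z)) := by
    rw [distant_affinePoint_iff]
    intro h
    refine hw (h.1 ?_)
    rw [LinearMap.sub_apply, hza, centerEmbedding_apply, haw, sub_self, map_zero]
  -- The witness is a followed by z; it agrees with z on the fixed vector w of a. It coincides with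
  -- α exactly when z = 1, the reason for the alternative β = α in `OnChain`.
  refine ⟨affinePoint (a * centerEmbedding K U z), ?_, distant_affinePoint_infPoint _, hnot⟩
  by_cases hz1 : z = 1
  · exact Or.inl (by rw [hz1, map_one, mul_one])
  have hz1' : (1 : K) - z ≠ 0 := fun h => hz1 (Subtype.ext (sub_eq_zero.1 h).symm)
  have hne : ∀ k : K, k ≠ 0 → k • w ≠ 0 := fun k hk => smul_ne_zero hk hw
  refine Or.inr (inPencil_iff.2 ⟨h1, fun h => ?_, fun h => ?_, ?_⟩)
  · have := congrArg (fun f => f.unop w) (affinePoint_injective h)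
    simp only [hza, haw, MulOpposite.unop_zero, LinearMap.zero_apply] at this
    exact hne _ hz' this.symm
  · have := congrArg (fun f => f.unop w) (affinePoint_injective h)
    simp only [hza, haw] at this
    exact hne _ hz1' (by rw [sub_smul, one_smul, ← this, sub_self])
  · simp only [subspace_affinePoint]
    refine complSubset_of_covBy (graph_covBy hw (by simp)) (graph_covBy hw ha)
      (graph_covBy hw fun u => Submodule.smul_mem _ _ (ha u)) ?_
    rintro x ⟨hx, hy⟩
    have hx : x.2 = a.unop x.1 := hx
    have hy : x.2 = (z : K) • a.unop x.1 := hy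
    have h5 : ((1 : K) - z) • x.2 = 0 := by rw [sub_smul, one_smul, hx, ← hy, hx, sub_self]
    simpa [LinearMap.mem_graph_iff, hz1'] using h5

theorem exists_idempotent_of_notMem_span {v w : U} (h : w ∉ Submodule.span K {v}) :
    ∃ e : Module.End K U, e w = w ∧ e v = 0 ∧ ∀ u, e u ∈ Submodule.span K {w} := by
  obtain ⟨f, hf, hfw⟩ := LinearMap.exists_extend_of_notMem
    (0 : Submodule.span K {v} →ₗ[K] K) h 1
  have hfv : f v = 0 := LinearMap.congr_fun hf ⟨v, Submodule.mem_span_singleton_self v⟩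
  exact ⟨f.smulRight w, by simp [hfw], by simp [hfv],
    fun u => Submodule.smul_mem _ _ (Submodule.mem_span_singleton_self w)⟩

/-- The third member is R(1 - e, e), with subspace `skewRange e`. A multiple of e would need a
scalar other than 0 and 1, which is absent if K has two elements. -/
theorem exists_inPencil {e : Module.End K U} {w : U} (hw : w ≠ 0) (hew : e w = w)
    (he : ∀ u, e u ∈ Submodule.span K {w}) :
    ∃ γ, InPencil Distant (affinePoint 0) (affinePoint (MulOpposite.op e)) γ := by
  have hee : ∀ u, e (e u) = e u := fun u => by
    obtain ⟨t, ht⟩ := Submodule.mem_span_singleton.1 (he u)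
    rw [← ht, map_smul, hew]
  have hid : IsIdempotentElem (MulOpposite.op e) :=
    MulOpposite.unop_injective (LinearMap.ext hee)
  have hC : subspace (cyclic (1 - MulOpposite.op e) (MulOpposite.op e)) = skewRange e := by
    rw [subspace_cyclic]
    rfl
  have hmem : ((0, w) : U × U) ∈ skewRange e := mem_skewRange.2 ⟨w, by simp [hew], hew⟩
  have hgraph : ∀ f : EndRight K U, affinePoint f ≠
      ⟨_, cyclic_mem_projLine_of_isIdempotentElem hid⟩ := by
    intro f h
    have h' := congrArg (fun p => subspace p.1) h
    simp only [subspace_affinePoint, hC] at h'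
    rw [← h', LinearMap.mem_graph_iff, map_zero] at hmem
    exact hw hmem
  refine ⟨⟨_, cyclic_mem_projLine_of_isIdempotentElem hid⟩, inPencil_iff.2
    ⟨fun h => ?_, hgraph _, hgraph _, ?_⟩⟩
  · have h' := congrArg (fun f => f.unop w) (affinePoint_injective h)
    exact hw (hew.symm.trans h'.symm)
  · simp only [subspace_affinePoint, hC]
    refine complSubset_of_covBy (graph_covBy hw (by simp)) (graph_covBy hw he)
      (skewRange_covBy hw hew he) ?_
    rintro x ⟨hx, hy⟩
    obtain ⟨u, h1, h2⟩ := mem_skewRange.1 hy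
    have hx : x.2 = e x.1 := hx
    rw [LinearMap.mem_graph_iff, hx, ← h1, map_sub, hee, sub_self]
    rfl

/-- A bijection minus a map of rank one that vanishes on the preimage of its range. -/
theorem bijective_sub_of_apply_eq_zero {f b : Module.End K U} (hf : Function.Bijective f) {v : U}
    (hb : ∀ u, b u ∈ Submodule.span K {f v}) (hv : b v = 0) : Function.Bijective (b - f) := by
  refine ⟨(injective_iff_map_eq_zero _).2 fun u hu => ?_, fun y => ?_⟩
  · rw [LinearMap.sub_apply, sub_eq_zero] at hu
    obtain ⟨t, ht⟩ := Submodule.mem_span_singleton.1 (hb u)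
    have h1 : t • v = u := hf.1 (by rw [map_smul, ht, hu])
    have h2 : b u = 0 := by rw [← h1, map_smul, hv, smul_zero]
    exact hf.1 (by rw [← hu, h2, map_zero])
  · obtain ⟨x, hx⟩ := hf.2 (-y)
    obtain ⟨t, ht⟩ := Submodule.mem_span_singleton.1 (hb x)
    -- As fx = -y, bx = t(fv) and bv = 0, the terms t(fv) cancel and y remains.
    refine ⟨x + t • v, ?_⟩
    simp [hv, hx, ht]

theorem mem_standardChain_of_onChain (hU : 1 < Module.rank K U) {p : projLine (EndRight K U)}
    (hp : OnChain Distant (infPoint _) (affinePoint 0) (affinePoint 1) p) :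
    p ∈ standardChain (centerEmbedding K U) := by
  rw [mem_standardChain_iff]
  rcases hp with rfl | rfl | ⟨h1, h2, h3⟩
  · exact Or.inl rfl
  · exact Or.inr ⟨0, by rw [map_zero]⟩
  right
  obtain ⟨f, rfl⟩ := exists_eq_affinePoint h1
  rw [distant_affinePoint_iff, MulOpposite.unop_zero, sub_zero] at h2
  -- If v and fv are independent, test the condition on the projection e onto K(fv) that kills v.
  have key : ∀ v, ¬ LinearIndependent K ![v, f.unop v] := by
    intro v hv
    have hw : f.unop v ∉ Submodule.span K {v} := by
      rw [Submodule.mem_span_singleton]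
      rintro ⟨t, ht⟩
      rw [LinearIndependent.pair_iff] at hv
      exact one_ne_zero (neg_eq_zero.1 (hv t (-1) (by simp [ht])).2)
    have hw0 : f.unop v ≠ 0 := fun h => hw (h ▸ Submodule.zero_mem _)
    obtain ⟨e, hew, hev, he⟩ := exists_idempotent_of_notMem_span hw
    have h4 : ¬ Distant (affinePoint (MulOpposite.op e)) (affinePoint 1) := by
      rw [distant_affinePoint_iff]
      intro h
      refine hw0 (h.1 ?_)
      simp [hew]
    obtain ⟨β, hβ, hβi, hβf⟩ := h3 _ (exists_inPencil hw0 hew he)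
      (distant_affinePoint_infPoint _) h4
    obtain ⟨b, rfl⟩ := exists_eq_affinePoint hβi
    have hb : (∀ u, b.unop u ∈ Submodule.span K {f.unop v}) ∧ b.unop v = 0 := by
      rcases hβ with hβ | hβ
      · rw [affinePoint_injective hβ]
        exact ⟨he, hev⟩
      · obtain ⟨h5, h6, -, h7⟩ := inPencil_iff.1 hβ
        have h5' := fun h => h5 (subspace_injective h)
        have h6' := fun h => h6 (subspace_injective h)
        -- The common join puts the range of b into K(fv); the common meet contains (v, 0), so b
        -- kills v.
        have hs := (h7.sup_eq (atomsSeparate_submodule K (U × U)) h5' h6').1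
        have hi := h7.inf_eq (atomsSeparate_submodule K (U × U)) h5' h6'
        simp only [subspace_affinePoint, MulOpposite.unop_zero, MulOpposite.unop_op] at hs hi
        constructor
        · intro u
          have h8 : (u, b.unop u) ∈ (0 : Module.End K U).graph ⊔ e.graph :=
            hs ▸ Submodule.mem_sup_right (by simp)
          exact (sup_le (graph_covBy hw0 (by simp)).le (graph_covBy hw0 he).le h8).2
        · have h8 : ((v, 0) : U × U) ∈ (0 : Module.End K U).graph ⊓ b.unop.graph :=
            hi ▸ ⟨by simp [LinearMap.mem_graph_iff], by simp [LinearMap.mem_graph_iff, hev]⟩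
          exact (LinearMap.mem_graph_iff _ _).1 h8.2 |>.symm
    apply hβf
    rw [distant_affinePoint_iff]
    exact bijective_sub_of_apply_eq_zero h2 hb.1 hb.2
  -- In dimension 1 the condition `key` would be void. For infinite dimension `finrank` is 0, which
  -- is harmless here.
  have hfin : Module.finrank K U ≠ 1 := by
    intro h
    rw [Module.rank_eq_one_iff_finrank_eq_one.2 h] at hU
    exact lt_irrefl _ hU
  obtain ⟨z, hz⟩ :=
    LinearMap.exists_mem_center_apply_eq_smul_of_forall_notLinearIndependent hfin key
  refine ⟨z, congrArg affinePoint (MulOpposite.unop_injective ?_)⟩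
  rw [hz]
  rfl

end Chain

/-! ### Transitivity, and the passage between chains and the distant graph -/

section Automorphisms

variable {K U : Type*} [DivisionRing K] [AddCommGroup U] [Module K U]

/-- `GL(2, R)` is transitive on the triples of mutually distant points. -/
theorem exists_movePerm_eq {A B W : projLine (EndRight K U)} (hBA : Distant B A)
    (hWA : Distant W A) (hWB : Distant W B) :
    ∃ g : GL2 (EndRight K U), movePerm g (infPoint _) = A ∧
      movePerm g (affinePoint 0) = B ∧ movePerm g (affinePoint 1) = W := by
  obtain ⟨k, hB, hA⟩ := hBA
  have hA' : movePerm k (infPoint _) = A := Subtype.ext hA.symm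
  have hB' : movePerm k (affinePoint 0) = B := Subtype.ext hB.symm
  obtain ⟨W, rfl⟩ := (movePerm k).surjective W
  rw [← hA', distant_movePerm_iff] at hWA
  rw [← hB', distant_movePerm_iff] at hWB
  obtain ⟨f, rfl⟩ := exists_eq_affinePoint hWA
  rw [distant_affinePoint_iff, MulOpposite.unop_zero, sub_zero, ← Module.End.isUnit_iff] at hWB
  obtain ⟨f, rfl⟩ : IsUnit f := hWB.op
  -- diag(1, f) fixes R(0, 1) and R(1, 0) and takes R(1, 1) to R(1, f); f is a unit because W is
  -- distant to B.
  let d : GL2 (EndRight K U) := ⟨!![1, 0; 0, f], !![1, 0; 0, ↑f⁻¹],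
    by simp [Matrix.one_fin_two], by simp [Matrix.one_fin_two]⟩
  have hd : ∀ a b : EndRight K U, moveSubmodule d (cyclic a b) = cyclic a (b * f) := fun a b => by
    rw [moveSubmodule_cyclic]
    simp [d]
  have hmul : ∀ p q : projLine (EndRight K U), moveSubmodule d p.1 = q.1 →
      movePerm (d * k) p = movePerm k q := fun p q h => by
    apply Subtype.ext
    change moveSubmodule (d * k) p.1 = moveSubmodule k q.1
    rw [moveSubmodule_mul, h]
  refine ⟨d * k, (hmul _ _ ?_).trans hA', (hmul _ _ ?_).trans hB', hmul _ _ ?_⟩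
  · rw [infPoint, hd]
    have := cyclic_mul_left_of_isUnit f.isUnit 0 1
    simpa using this
  · rw [affinePoint, hd, zero_mul]
  · rw [affinePoint, hd, one_mul, affinePoint]

theorem standardChain_eq (hU : 1 < Module.rank K U) :
    standardChain (centerEmbedding K U) =
      {p | OnChain Distant (infPoint _) (affinePoint 0) (affinePoint 1) p} :=
  Set.ext fun _ => ⟨onChain_of_mem_standardChain, mem_standardChain_of_onChain hU⟩

/-- The chains are exactly the sets described by three mutually distant points. -/
theorem mem_chains_iff (hU : 1 < Module.rank K U) {C : Set (projLine (EndRight K U))} :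
    C ∈ chains (centerEmbedding K U) ↔ ∃ A B W, Distant B A ∧ Distant W A ∧ Distant W B ∧
      C = {p | OnChain Distant A B W p} := by
  have key : ∀ g : GL2 (EndRight K U), movePoint g '' standardChain (centerEmbedding K U) =
      {p | OnChain Distant (movePerm g (infPoint _)) (movePerm g (affinePoint 0))
        (movePerm g (affinePoint 1)) p} := fun g => by
    rw [standardChain_eq hU]
    exact image_onChain (σ := movePerm g) (distant_movePerm_iff g) _ _ _
  constructor
  · rintro ⟨g, rfl⟩
    refine ⟨_, _, _, ?_, ?_, ?_, key g⟩ <;> rw [distant_movePerm_iff]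
    · exact distant_affinePoint_infPoint _
    · exact distant_affinePoint_infPoint _
    · simpa using distant_of_center_ne (U := U) (one_ne_zero (α := Subring.center K))
  · rintro ⟨A, B, W, hBA, hWA, hWB, rfl⟩
    obtain ⟨g, rfl, rfl, rfl⟩ := exists_movePerm_eq hBA hWA hWB
    exact ⟨g, (key g).symm⟩

/-- A point distant to itself would have a self-complementary subspace, forcing U × U = 0. -/
theorem distantGraph_adj_iff_distant [Nontrivial U] {p q : projLine (EndRight K U)} :
    (distantGraph (EndRight K U)).Adj p q ↔ Distant p q := by
  refine ⟨fun h => h.2, fun h => ⟨?_, h⟩⟩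
  rintro rfl
  have h1 := distant_iff_isCompl.1 h
  exact bot_ne_top (h1.inf_eq_bot.symm.trans (inf_idem _ |>.trans
    ((sup_idem _).symm.trans h1.sup_eq_top)))

/-- The standard chain contains R(1, 0) and R(0, 1), and its distinct points are mutually distant
since a nonzero central scalar acts invertibly; GL(2, R) transports both facts. -/
theorem distantGraph_adj_iff_exists_chain {p q : projLine (EndRight K U)} :
    (distantGraph (EndRight K U)).Adj p q ↔
      p ≠ q ∧ ∃ C ∈ chains (centerEmbedding K U), p ∈ C ∧ q ∈ C := by
  refine and_congr_right fun hne => ⟨?_, ?_⟩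
  · rintro ⟨g, hp, hq⟩
    refine ⟨_, ⟨g, rfl⟩, ⟨affinePoint (centerEmbedding K U 0),
      mem_standardChain_iff.2 (Or.inr ⟨0, rfl⟩), Subtype.ext ?_⟩,
      ⟨infPoint _, mem_standardChain_iff.2 (Or.inl rfl), Subtype.ext hq.symm⟩⟩
    rw [map_zero]
    exact hp.symm
  · rintro ⟨_, ⟨g, rfl⟩, ⟨p, hp, rfl⟩, ⟨q, hq, rfl⟩⟩
    refine Distant.movePoint ?_ g
    rcases mem_standardChain_iff.1 hp with rfl | ⟨y, rfl⟩ <;>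
      rcases mem_standardChain_iff.1 hq with rfl | ⟨z, rfl⟩
    · exact absurd rfl hne
    · exact (distant_affinePoint_infPoint _).symm
    · exact distant_affinePoint_infPoint _
    · exact distant_of_center_ne fun h => hne (by rw [h])

theorem image_mem_chains (hU : 1 < Module.rank K U) {σ : Equiv.Perm (projLine (EndRight K U))}
    (hσ : ∀ p q, Distant (σ p) (σ q) ↔ Distant p q) {C : Set (projLine (EndRight K U))}
    (hC : C ∈ chains (centerEmbedding K U)) : σ '' C ∈ chains (centerEmbedding K U) := by
  rw [mem_chains_iff hU] at hC ⊢
  obtain ⟨A, B, W, hBA, hWA, hWB, rfl⟩ := hC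
  exact ⟨σ A, σ B, σ W, (hσ _ _).2 hBA, (hσ _ _).2 hWA, (hσ _ _).2 hWB, image_onChain hσ _ _ _⟩

end Automorphisms

end ChainGeometry

/-- Let `K` be a division ring with centre `Z`, let `U` be a left vector space over `K` of finite
or infinite dimension greater than `1`, and let `R` be its endomorphism ring. The automorphisms of
the distant graph on the projective line over `R` are precisely the automorphisms of the chain
geometry `Σ(Z, R)`. -/
theorem corollary5p4 (K U : Type*) [DivisionRing K] [AddCommGroup U] [Module K U]
    (hU : 1 < Module.rank K U)
    (σ : Equiv.Perm (ChainGeometry.projLine (ChainGeometry.EndRight K U))) :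
    ChainGeometry.IsDistantAut σ ↔
      ChainGeometry.IsChainAut (ChainGeometry.centerEmbedding K U) σ := by
  open ChainGeometry in
  have : Nontrivial U := rank_pos_iff_nontrivial.1 (zero_lt_one.trans hU)
  constructor
  · intro h C
    have hσ : ∀ p q, Distant (σ p) (σ q) ↔ Distant p q := fun p q => by
      simpa only [distantGraph_adj_iff_distant] using h p q
    refine ⟨fun hC => ?_, image_mem_chains hU hσ⟩
    have hσ' : ∀ p q, Distant (σ.symm p) (σ.symm q) ↔ Distant p q := fun p q => by
      rw [← hσ, σ.apply_symm_apply, σ.apply_symm_apply]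
    simpa only [Equiv.symm_image_image] using image_mem_chains hU hσ' hC
  · intro h p q
    rw [distantGraph_adj_iff_exists_chain, distantGraph_adj_iff_exists_chain,
      σ.injective.ne_iff]
    refine and_congr_right fun _ => ⟨?_, ?_⟩
    · rintro ⟨C, hC, hp, hq⟩
      refine ⟨σ ⁻¹' C, (h _).1 ?_, hp, hq⟩
      rwa [Set.image_preimage_eq C σ.surjective]
    · rintro ⟨C, hC, hp, hq⟩
      exact ⟨σ '' C, (h C).2 hC, Set.mem_image_of_mem σ hp, Set.mem_image_of_mem σ hq⟩
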